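/- Let $G$ be a finitely generated group. For a finite subset $A\subseteq G$, let $A^*$ be the set of all finite words over the alphabet $A$, $A^+$ the set of nonempty ones, and $\varepsilon$ the empty word; write $u\sim v$ if the words $u,v\in A^*$ represent the same element of $G$. A *dictionary* over $A$ is a regular language $L\subseteq A^+$ in which every element of $G$ is represented by at least one word. For $a\in A\cup\{\varepsilon\}$ put $$R_a^L=\{(u,v)\in L\times L \mid ua\sim v\}.$$ The dictionary $L$ is *quasi-automatic* if every $R_a^L$ $(a\in A\cup\{\varepsilon\})$ is a rational relation, i.e. belongs to the smallest family of subsets of the monoid $A^*\times A^*$ that contains the finite subsets and is closed under union, product and Kleene star. It is *asynchronously automatic* if every $R_a^L$ $(a\in A\cup\{\varepsilon\})$ is recognized by a finite deterministic asynchronous two-tape automaton, that is, an automaton in which each state determines from which of the two tapes the next symbol is read, each state and symbol read determine the next state, and a pair $(u,v)$ is accepted if, with $u\$$ and $v\$$ written on the tapes ($\$$ being an end marker), the automaton reads both tapes completely and ends in an accepting state. The group $G$ is *quasi-automatic* (respectively *asynchronously automatic*) if it has a quasi-automatic (respectively asynchronously automatic) dictionary over some finite subset $A\subseteq G$ (which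 then necessarily generates $G$ as a semigroup). **Theorem.** A finitely generated group $G$ is quasi-automatic if and only if it is asynchronously automatic. -/

import Mathlib

/-- The rational subsets of a monoid: the smallest family of subsets that contains the empty set and
the singletons (hence all finite subsets) and is closed under union, product and Kleene star
(the submonoid generated by a subset). -/
inductive IsRationalSet {M : Type*} [Monoid M] : Set M → Prop
  | empty : IsRationalSet ∅
  | singleton (m : M) : IsRationalSet {m}
  | union {X Y : Set M} : IsRationalSet X → IsRationalSet Y → IsRationalSet (X ∪ Y)
  | mul {X Y : Set M} : IsRationalSet X → IsRationalSet Y →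
      IsRationalSet {m | ∃ x ∈ X, ∃ y ∈ Y, m = x * y}
  | star {X : Set M} : IsRationalSet X → IsRationalSet (Submonoid.closure X : Set M)

/-- The two tapes of a two-tape automaton. -/
inductive Tape : Type
  | left : Tape
  | right : Tape

/-- An asynchronous (deterministic) two-tape automaton over the alphabet `α` with states `σ`.
Each state determines the tape from which the next symbol is read. The symbols are the elements of
`Option α`: a letter `some a`, or the end-of-tape marker `none`. -/
structure TwoTapeAutomaton (α : Type*) (σ : Type*) where
  /-- the tape read in a given state -/
  tape : σ → Tape
  /-- the transition function -/
  step : σ → Option α → σ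
  /-- the initial state -/
  start : σ
  /-- the accepting states -/
  accept : Set σ

namespace TwoTapeAutomaton

/-- `M.AcceptsFrom q x y`: started in state `q` with contents `x`, `y` still unread on the left and
right tapes, the automaton reads both tapes entirely and ends in an accepting state. -/
inductive AcceptsFrom {α σ : Type*} (M : TwoTapeAutomaton α σ) :
    σ → List (Option α) → List (Option α) → Prop
  | done {q : σ} : q ∈ M.accept → AcceptsFrom M q [] []
  | left {q : σ} {c : Option α} {x y : List (Option α)} : M.tape q = Tape.left →
      AcceptsFrom M (M.step q c) x y → AcceptsFrom M q (c :: x) y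
  | right {q : σ} {c : Option α} {x y : List (Option α)} : M.tape q = Tape.right →
      AcceptsFrom M (M.step q c) x y → AcceptsFrom M q x (c :: y)

/-- The relation recognized by `M`: the pairs of words `(u, v)` such that `M` accepts when `u` and
`v`, each followed by the end marker, are written on its tapes. -/
def recognized {α σ : Type*} (M : TwoTapeAutomaton α σ) : Set (FreeMonoid α × FreeMonoid α) :=
  {p | M.AcceptsFrom M.start (p.1.toList.map some ++ [none]) (p.2.toList.map some ++ [none])}

end TwoTapeAutomaton

/-- A relation between words is recognized by some finite asynchronous two-tape automaton. -/
def IsTwoTapeRecognizable {α : Type*} (R : Set (FreeMonoid α × FreeMonoid α)) : Prop :=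
  ∃ (σ : Type) (_ : Finite σ) (M : TwoTapeAutomaton α σ), M.recognized = R

section Dictionaries

variable {G : Type*} [Group G]

/-- A dictionary over `A`: a regular language of nonempty words over `A` that maps onto `G`.
In particular `A` then generates `G` as a semigroup. -/
structure IsDictionary (A : Finset G) (L : Language A) : Prop where
  regular : L.IsRegular
  ne_nil : ∀ w ∈ L, w ≠ []
  surjective : ∀ g : G, ∃ w ∈ L, FreeMonoid.lift (fun a : A => (a : G)) (FreeMonoid.ofList w) = g

/-- The relation `R_a = {(u, v) ∈ L × L | u a ∼ v}` for `a ∈ A ∪ {ε}`, where `∼` means that two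
words represent the same element of `G`; `none` stands for `ε`. -/
def multiplierRelation (A : Finset G) (L : Language A) (a : Option A) :
    Set (FreeMonoid A × FreeMonoid A) :=
  {p | p.1.toList ∈ L ∧ p.2.toList ∈ L ∧
    FreeMonoid.lift (fun b : A => (b : G)) (p.1 * a.elim 1 FreeMonoid.of) =
      FreeMonoid.lift (fun b : A => (b : G)) p.2}

/-- A quasi-automatic dictionary: all the relations `R_a`, `a ∈ A ∪ {ε}`, are rational. -/
def IsQuasiAutomaticDictionary (A : Finset G) (L : Language A) : Prop :=
  IsDictionary A L ∧ ∀ a : Option A, IsRationalSet (multiplierRelation A L a)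

/-- An asynchronously automatic dictionary: all the relations `R_a`, `a ∈ A ∪ {ε}`, are recognized
by finite asynchronous two-tape automata. -/
def IsAsynchronouslyAutomaticDictionary (A : Finset G) (L : Language A) : Prop :=
  IsDictionary A L ∧ ∀ a : Option A, IsTwoTapeRecognizable (multiplierRelation A L a)

end Dictionaries

/-- A group is quasi-automatic if it has a quasi-automatic dictionary over some finite generating
set. -/
def IsQuasiAutomatic (G : Type*) [Group G] : Prop :=
  ∃ (A : Finset G) (L : Language A), IsQuasiAutomaticDictionary A L

/-- A group is asynchronously automatic if it has an asynchronously automatic dictionary over some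
finite generating set. -/
def IsAsynchronouslyAutomatic (G : Type*) [Group G] : Prop :=
  ∃ (A : Finset G) (L : Language A), IsAsynchronouslyAutomaticDictionary A L

/-! ### Closure properties of regular languages -/

/-! A rational relation is the image under `toPair` of a regular language of interleavings
(`IsRationalSet.exists_isRegular`); the difficulty is to choose the interleaving deterministically.
The converse is Kleene's argument: a two-tape automaton is a finite graph labelled by pairs of
words, so its relation is rational (`LabelledPath.isRationalSet`), and the same dictionary serves.

To pass from quasi-automatic to asynchronously automatic, thin the dictionary. Let `N` be the number
of states of a DFA for the interleavings of `R_ε`, and discard each word from which deleting a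
nonempty trivial factor of length at most `N` leaves a word of the dictionary. By pumping, only
finitely many of the remaining words represent a given element (`finite_reducedWords_fiber`).

In a DFA for `R_a`, a state that can still accept determines the quotient of the right value by the
left value. Hence two readings with the same left word and compatible right words differ on the
right by a factor from a finite set, which bounds their delay (`DFA.exists_hasBoundedDelay`). A
subset construction with a bounded buffer for the right tape then recognizes the relation
(`DFA.determinize_sound`, `DFA.determinize_complete`). -/

theorem DFA.append_mem_accepts {α σ : Type*} {M : DFA α σ} {x y : List α} :
    x ++ y ∈ M.accepts ↔ M.evalFrom (M.eval x) y ∈ M.accept := by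
  rw [DFA.mem_accepts, DFA.eval, DFA.evalFrom_of_append]

open scoped Computability

namespace Language

variable {α : Type*}

/-- Myhill–Nerode: by symmetry of `h`, the left quotient by `x` depends only on `f x`. No transition
function on `β` is required. -/
theorem IsRegular.of_finite_invariant {L : Language α} {β : Type*} [Finite β] (f : List α → β)
    (h : ∀ x x' y, f x = f x' → x ++ y ∈ L → x' ++ y ∈ L) : L.IsRegular := by
  apply IsRegular.of_finite_range_leftQuotient
  refine (Set.finite_range fun b : Set.range f => L.leftQuotient b.2.choose).subset ?_
  rintro _ ⟨x, rfl⟩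
  refine ⟨⟨f x, x, rfl⟩, ?_⟩
  have hx : f (Set.mem_range_self x : f x ∈ Set.range f).choose = f x :=
    (Set.mem_range_self x : f x ∈ Set.range f).choose_spec
  ext y
  exact ⟨h _ _ y hx, h _ _ y hx.symm⟩

theorem isRegular_bot : (0 : Language α).IsRegular :=
  .of_finite_invariant (β := Unit) (fun _ => ()) fun _ _ _ _ h => (notMem_zero _ h).elim

theorem isRegular_singleton (w : List α) : ({w} : Language α).IsRegular := by
  apply IsRegular.of_finite_range_leftQuotient
  refine (((List.finite_toSet (w.inits.map fun x => ({w.drop x.length} : Language α)))).insert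
    (0 : Language α)).subset ?_
  rintro _ ⟨x, rfl⟩
  by_cases hx : x <+: w
  · right
    simp only [List.mem_map, List.mem_inits, Set.mem_ofPred_eq]
    obtain ⟨y, rfl⟩ := hx
    refine ⟨x, ⟨y, rfl⟩, ?_⟩
    ext z
    rw [mem_leftQuotient]
    change z = _ ↔ x ++ z = x ++ y
    simp
  · left
    ext z
    rw [mem_leftQuotient]
    refine ⟨fun h => (hx ⟨z, h⟩).elim, fun h => (notMem_zero _ h).elim⟩

theorem IsRegular.mul {L K : Language α} (hL : L.IsRegular) (hK : K.IsRegular) :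
    (L * K).IsRegular := by
  obtain ⟨σ, _, M, rfl⟩ := hL
  obtain ⟨τ, _, N, rfl⟩ := hK
  refine .of_finite_invariant (β := σ × Set τ)
    (fun x => (M.eval x, {q | ∃ x₁ x₂, x = x₁ ++ x₂ ∧ x₁ ∈ M.accepts ∧ N.eval x₂ = q})) ?_
  intro x x' y hf hxy
  simp only [Prod.mk.injEq] at hf
  obtain ⟨hM, hN⟩ := hf
  obtain ⟨a, ha, b, hb, hab⟩ := mem_mul.1 hxy
  rw [mem_mul]
  -- The boundary between the two factors lies inside the prefix already read or inside `y`.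
  rcases List.append_eq_append_iff.1 hab with ⟨c, rfl, rfl⟩ | ⟨c, rfl, rfl⟩
  · have : N.eval c ∈ {q | ∃ x₁ x₂, a ++ c = x₁ ++ x₂ ∧ x₁ ∈ M.accepts ∧ N.eval x₂ = q} :=
      ⟨a, c, rfl, ha, rfl⟩
    rw [hN] at this
    obtain ⟨x₁, x₂, rfl, h₁, h₂⟩ := this
    refine ⟨x₁, h₁, x₂ ++ y, ?_, by simp⟩
    rw [DFA.append_mem_accepts, h₂]
    exact DFA.append_mem_accepts.1 hb
  · refine ⟨x' ++ c, ?_, b, hb, by simp⟩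
    rw [DFA.append_mem_accepts] at ha ⊢
    rwa [← hM]

theorem append_mem_kstar {L : Language α} {x y : List α} (hx : x ∈ L∗) (hy : y ∈ L∗) :
    x ++ y ∈ L∗ := by
  obtain ⟨S, rfl, hS⟩ := mem_kstar.1 hx
  obtain ⟨T, rfl, hT⟩ := mem_kstar.1 hy
  refine mem_kstar.2 ⟨S ++ T, by simp, ?_⟩
  simp only [List.mem_append]
  rintro z (h | h)
  exacts [hS z h, hT z h]

theorem self_subset_kstar {L : Language α} {x : List α} (hx : x ∈ L) : x ∈ L∗ :=
  mem_kstar.2 ⟨[x], by simp, by simpa⟩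

/-- The cut between `x` and `y` falls between two factors or within one. -/
theorem exists_split_of_append_mem_kstar {L : Language α} {x y : List α} (h : x ++ y ∈ L∗) :
    x ∈ L∗ ∧ y ∈ L∗ ∨ ∃ x₁ x₂ y₁ y₂, x = x₁ ++ x₂ ∧ y = y₁ ++ y₂ ∧ x₁ ∈ L∗ ∧ x₂ ++ y₁ ∈ L ∧
      y₂ ∈ L∗ := by
  obtain ⟨S, hS, hL⟩ := mem_kstar.1 h
  clear h
  induction S generalizing x with
  | nil =>
    obtain ⟨rfl, rfl⟩ : x = [] ∧ y = [] := by simpa using hS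
    exact .inl ⟨nil_mem_kstar _, nil_mem_kstar _⟩
  | cons s S ih =>
    have hs : s ∈ L := hL s (by simp)
    have hS' : S.flatten ∈ L∗ := mem_kstar.2 ⟨S, rfl, fun z hz => hL z (by simp [hz])⟩
    rw [List.flatten_cons] at hS
    rcases List.append_eq_append_iff.1 hS with ⟨c, rfl, rfl⟩ | ⟨c, rfl, hc⟩
    · exact .inr ⟨[], x, c, S.flatten, rfl, rfl, nil_mem_kstar _, hs, hS'⟩
    · rcases ih hc.symm (fun z hz => hL z (by simp [hz])) with
        ⟨h₁, h₂⟩ | ⟨x₁, x₂, y₁, y₂, rfl, rfl, h₁, h₂, h₃⟩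
      · exact .inl ⟨append_mem_kstar (self_subset_kstar hs) h₁, h₂⟩
      · exact .inr ⟨s ++ x₁, x₂, y₁, y₂, by simp, rfl,
          append_mem_kstar (self_subset_kstar hs) h₁, h₂, h₃⟩

theorem IsRegular.kstar {L : Language α} (hL : L.IsRegular) : (L∗).IsRegular := by
  obtain ⟨σ, _, M, rfl⟩ := hL
  refine .of_finite_invariant (β := Prop × Set σ)
    (fun x => (x ∈ M.accepts∗, {q | ∃ x₁ x₂, x = x₁ ++ x₂ ∧ x₁ ∈ M.accepts∗ ∧ M.eval x₂ = q})) ?_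
  intro x x' y hf hxy
  simp only [Prod.mk.injEq] at hf
  obtain ⟨hx, hM⟩ := hf
  rcases exists_split_of_append_mem_kstar hxy with
    ⟨h₁, h₂⟩ | ⟨x₁, x₂, y₁, y₂, rfl, rfl, h₁, h₂, h₃⟩
  · exact append_mem_kstar (hx ▸ h₁) h₂
  · have : M.eval x₂ ∈ {q | ∃ z₁ z₂, x₁ ++ x₂ = z₁ ++ z₂ ∧ z₁ ∈ M.accepts∗ ∧ M.eval z₂ = q} :=
      ⟨x₁, x₂, rfl, h₁, rfl⟩
    rw [hM] at this
    obtain ⟨z₁, z₂, rfl, k₁, k₂⟩ := this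
    have : z₂ ++ y₁ ∈ M.accepts := by
      rw [DFA.append_mem_accepts] at h₂ ⊢
      rwa [k₂]
    simpa using append_mem_kstar (append_mem_kstar k₁ (self_subset_kstar this)) h₃

/-- The preimage of a language under a homomorphism. -/
def comapFlatMap {β : Type*} (L : Language β) (f : α → List β) : Language α :=
  {w | w.flatMap f ∈ L}

theorem IsRegular.comapFlatMap {β : Type*} {L : Language β} (hL : L.IsRegular)
    (f : α → List β) : (L.comapFlatMap f).IsRegular := by
  obtain ⟨σ, _, M, rfl⟩ := hL
  refine .of_finite_invariant (β := σ) (fun x => M.eval (x.flatMap f)) ?_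
  intro x x' y hf hxy
  change (x ++ y).flatMap f ∈ M.accepts at hxy
  change (x' ++ y).flatMap f ∈ M.accepts
  rw [List.flatMap_append, DFA.append_mem_accepts] at hxy ⊢
  rwa [← hf]

/-- The words obtained from words of `L` by inserting a factor that belongs to `F`. -/
def insertFactor (L : Language α) (F : Set (List α)) : Language α :=
  {w | ∃ x y, ∃ t ∈ F, w = x ++ t ++ y ∧ x ++ y ∈ L}

theorem IsRegular.insertFactor {L : Language α} (hL : L.IsRegular) {F : Set (List α)}
    (hF : F.Finite) : (L.insertFactor F).IsRegular := by
  obtain ⟨σ, _, M, rfl⟩ := hL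
  have hS : {s : List α | ∃ t ∈ F, s <:+ t}.Finite := by
    have : {s : List α | ∃ t ∈ F, s <:+ t} = ⋃ t ∈ F, {s | s ∈ t.tails} := by
      ext s; simp
    rw [this]
    exact hF.biUnion fun t _ => List.finite_toSet _
  have := hS.to_subtype
  -- The components serve an inserted factor that starts after the prefix, straddles its end
  -- (recording the part still to come and the state before the factor), or lies inside it.
  refine .of_finite_invariant
    (β := σ × Set ({s : List α | ∃ t ∈ F, s <:+ t} × σ) × Set σ)
    (fun x => (M.eval x, {p | ∃ x₁ x₂, x = x₁ ++ x₂ ∧ x₂ ++ p.1 ∈ F ∧ M.eval x₁ = p.2},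
      {q | ∃ x₁ x₂ t, t ∈ F ∧ x = x₁ ++ t ++ x₂ ∧ M.eval (x₁ ++ x₂) = q})) ?_
  intro x x' y hf hxy
  simp only [Prod.mk.injEq] at hf
  obtain ⟨h₁, h₂, h₃⟩ := hf
  have key : ∀ {a b c : List α}, M.eval a = M.eval b → a ++ c ∈ M.accepts → b ++ c ∈ M.accepts := by
    intro a b c h hc
    rw [DFA.append_mem_accepts] at hc ⊢
    rwa [← h]
  obtain ⟨a, b, t, ht, he, hab⟩ := hxy
  rw [List.append_assoc] at he
  rcases List.append_eq_append_iff.1 he with ⟨c, rfl, rfl⟩ | ⟨c, rfl, hc⟩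
  · exact ⟨x' ++ c, b, t, ht, by simp, by
      rw [List.append_assoc] at hab ⊢; exact key h₁ hab⟩
  rcases List.append_eq_append_iff.1 hc with ⟨d, rfl, rfl⟩ | ⟨d, rfl, rfl⟩
  · have : M.eval (a ++ d) ∈
        {q | ∃ x₁ x₂ s, s ∈ F ∧ a ++ (t ++ d) = x₁ ++ s ++ x₂ ∧ M.eval (x₁ ++ x₂) = q} :=
      ⟨a, d, t, ht, by simp, rfl⟩
    rw [h₃] at this
    obtain ⟨x₁, x₂, s, hs, rfl, he⟩ := this
    refine ⟨x₁, x₂ ++ y, s, hs, by simp, ?_⟩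
    rw [← List.append_assoc] at hab ⊢
    exact key he.symm hab
  · have : ((⟨d, _, ht, ⟨c, rfl⟩⟩ : {s : List α | ∃ t ∈ F, s <:+ t}), M.eval a) ∈
        {p : {s : List α | ∃ t ∈ F, s <:+ t} × σ |
          ∃ x₁ x₂, a ++ c = x₁ ++ x₂ ∧ x₂ ++ p.1 ∈ F ∧ M.eval x₁ = p.2} :=
      ⟨a, c, rfl, ht, rfl⟩
    rw [h₂] at this
    obtain ⟨x₁, x₂, rfl, hs, he⟩ := this
    exact ⟨x₁, b, _, hs, by simp, key he.symm hab⟩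

end Language

/-! ### Rational relations as images of regular languages -/

section Pairs

variable {α : Type*}

/-- The word on the left tape described by an interleaving of two words. -/
def lefts (w : List (α ⊕ α)) : List α := w.flatMap (Sum.elim (fun a => [a]) fun _ => [])

/-- The word on the right tape described by an interleaving of two words. -/
def rights (w : List (α ⊕ α)) : List α := w.flatMap (Sum.elim (fun _ => []) fun a => [a])

@[simp] theorem lefts_nil : lefts ([] : List (α ⊕ α)) = [] := rfl
@[simp] theorem rights_nil : rights ([] : List (α ⊕ α)) = [] := rfl
@[simp] theorem lefts_cons_inl (a : α) (w : List (α ⊕ α)) :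
    lefts (.inl a :: w) = a :: lefts w := rfl
@[simp] theorem lefts_cons_inr (a : α) (w : List (α ⊕ α)) :
    lefts (.inr a :: w) = lefts w := rfl
@[simp] theorem rights_cons_inl (a : α) (w : List (α ⊕ α)) :
    rights (.inl a :: w) = rights w := rfl
@[simp] theorem rights_cons_inr (a : α) (w : List (α ⊕ α)) :
    rights (.inr a :: w) = a :: rights w := rfl
@[simp] theorem lefts_append (w z : List (α ⊕ α)) : lefts (w ++ z) = lefts w ++ lefts z :=
  List.flatMap_append
@[simp] theorem rights_append (w z : List (α ⊕ α)) : rights (w ++ z) = rights w ++ rights z :=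
  List.flatMap_append
@[simp] theorem lefts_map_inr (t : List α) : lefts (t.map Sum.inr) = [] := by
  induction t <;> simp_all
@[simp] theorem rights_map_inr (t : List α) : rights (t.map Sum.inr) = t := by
  induction t <;> simp_all

/-- The pair of words described by an interleaving. -/
def toPair (w : List (α ⊕ α)) : FreeMonoid α × FreeMonoid α :=
  (FreeMonoid.ofList (lefts w), FreeMonoid.ofList (rights w))

@[simp] theorem toPair_append (w z : List (α ⊕ α)) :
    toPair (w ++ z) = toPair w * toPair z := by
  simp [toPair]

theorem toPair_surjective : Function.Surjective (toPair : List (α ⊕ α) → _) := by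
  intro p
  refine ⟨p.1.toList.map Sum.inl ++ p.2.toList.map Sum.inr, ?_⟩
  have h₁ : ∀ t : List α, lefts (t.map Sum.inl) = t := by intro t; induction t <;> simp_all
  have h₂ : ∀ t : List α, rights (t.map Sum.inl) = [] := by intro t; induction t <;> simp_all
  ext1 <;> simp [toPair, h₁, h₂]

/-- Since `toPair` turns concatenation into multiplication, each rational operation lifts to the
same operation on regular languages. -/
theorem IsRationalSet.exists_isRegular {R : Set (FreeMonoid α × FreeMonoid α)}
    (hR : IsRationalSet R) : ∃ K : Language (α ⊕ α), K.IsRegular ∧ ∀ p, p ∈ R ↔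
      ∃ w ∈ K, toPair w = p := by
  induction hR with
  | empty => exact ⟨0, Language.isRegular_bot, fun p => by simp [Language.notMem_zero]⟩
  | singleton m =>
    obtain ⟨w, rfl⟩ := toPair_surjective m
    refine ⟨{w}, Language.isRegular_singleton w, fun p => ⟨?_, ?_⟩⟩
    · rintro rfl
      exact ⟨w, rfl, rfl⟩
    · rintro ⟨_, rfl, rfl⟩
      rfl
  | @union X Y _ _ hX hY =>
    obtain ⟨K, hK, hX⟩ := hX
    obtain ⟨K', hK', hY⟩ := hY
    refine ⟨K + K', hK.add hK', fun p => ?_⟩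
    simp only [Set.mem_union, hX, hY, Language.mem_add, or_and_right, exists_or]
  | @mul X Y _ _ hX hY =>
    obtain ⟨K, hK, hX⟩ := hX
    obtain ⟨K', hK', hY⟩ := hY
    refine ⟨K * K', hK.mul hK', fun p => ?_⟩
    simp only [Set.mem_ofPred_eq, hX, hY, Language.mem_mul]
    constructor
    · rintro ⟨_, ⟨w, hw, rfl⟩, _, ⟨z, hz, rfl⟩, rfl⟩
      exact ⟨_, ⟨w, hw, z, hz, rfl⟩, toPair_append w z⟩
    · rintro ⟨_, ⟨w, hw, z, hz, rfl⟩, rfl⟩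
      exact ⟨_, ⟨w, hw, rfl⟩, _, ⟨z, hz, rfl⟩, toPair_append w z⟩
  | @star X _ hX =>
    obtain ⟨K, hK, hX⟩ := hX
    refine ⟨K∗, hK.kstar, fun p => ⟨fun hp => ?_, ?_⟩⟩
    · induction hp using Submonoid.closure_induction with
      | mem x hx =>
        obtain ⟨w, hw, rfl⟩ := (hX x).1 hx
        exact ⟨w, Language.self_subset_kstar (L := K) hw, rfl⟩
      | one => exact ⟨[], Language.nil_mem_kstar _, rfl⟩
      | mul x y _ _ hx hy =>
        obtain ⟨w, hw, rfl⟩ := hx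
        obtain ⟨z, hz, rfl⟩ := hy
        exact ⟨w ++ z, Language.append_mem_kstar hw hz, toPair_append w z⟩
    · rintro ⟨w, hw, rfl⟩
      obtain ⟨S, rfl, hS⟩ := Language.mem_kstar.1 hw
      clear hw
      induction S with
      | nil => exact one_mem _
      | cons s S ih =>
        rw [List.flatten_cons, toPair_append]
        exact mul_mem (Submonoid.subset_closure ((hX _).2 ⟨s, hS s (by simp), rfl⟩))
          (ih fun z hz => hS z (by simp [hz]))

end Pairs

/-! ### Kleene's theorem: labels of paths in finite graphs form rational sets -/

section Kleene

variable {M : Type*} [Monoid M]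

theorem IsRationalSet.biUnion {ι : Type*} {s : Set ι} (hs : s.Finite) {X : ι → Set M}
    (hX : ∀ i ∈ s, IsRationalSet (X i)) : IsRationalSet (⋃ i ∈ s, X i) := by
  induction s, hs using Set.Finite.induction_on with
  | empty => simpa using IsRationalSet.empty
  | insert _ _ ih =>
    rw [Set.biUnion_insert]
    exact (hX _ (by simp)).union (ih fun i hi => hX i (by simp [hi]))

theorem IsRationalSet.iUnion {ι : Type*} [Finite ι] {X : ι → Set M}
    (hX : ∀ i, IsRationalSet (X i)) : IsRationalSet (⋃ i, X i) := by
  simpa using IsRationalSet.biUnion Set.finite_univ fun i _ => hX i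

theorem Set.Finite.isRationalSet {s : Set M} (hs : s.Finite) : IsRationalSet s := by
  simpa using IsRationalSet.biUnion hs fun m _ => IsRationalSet.singleton m

/-- `LabelledPath E p m q`: some path from `p` to `q` has label `m`, where `E p q` is the set of the
labels of the edges from `p` to `q`. -/
inductive LabelledPath {Q : Type*} (E : Q → Q → Set M) : Q → M → Q → Prop
  | nil (q : Q) : LabelledPath E q 1 q
  | cons {p r q : Q} {m n : M} : m ∈ E p r → LabelledPath E r n q → LabelledPath E p (m * n) q

namespace LabelledPath

variable {Q : Type*} {E E' : Q → Q → Set M} {p q r : Q} {m n : M}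

theorem mono (h : ∀ p q, E p q ⊆ E' p q) (hp : LabelledPath E p m q) : LabelledPath E' p m q := by
  induction hp with
  | nil => exact nil _
  | cons h₁ _ ih => exact cons (h _ _ h₁) ih

theorem trans (h₁ : LabelledPath E p m q) (h₂ : LabelledPath E q n r) :
    LabelledPath E p (m * n) r := by
  induction h₁ with
  | nil => simpa
  | cons h _ ih => rw [mul_assoc]; exact cons h (ih h₂)

/-- Kleene's elimination step: cut a path at its departures from `x`. Only sources of edges are
restricted, so the endpoint of a path is arbitrary. -/
theorem insert_iff {X : Set Q} {x : Q} :
    LabelledPath (fun p r => {m | p ∈ insert x X ∧ m ∈ E p r}) p m q ↔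
      LabelledPath (fun p r => {m | p ∈ X ∧ m ∈ E p r}) p m q ∨
      ∃ a, LabelledPath (fun p r => {m | p ∈ X ∧ m ∈ E p r}) p a x ∧
      ∃ b, (∃ c ∈ Submonoid.closure (⋃ r, {m | ∃ e ∈ E x r, ∃ n ∈
        {n | LabelledPath (fun p r => {m | p ∈ X ∧ m ∈ E p r}) r n x}, m = e * n}),
      ∃ d ∈ ⋃ r, {m | ∃ e ∈ E x r, ∃ n ∈
        {n | LabelledPath (fun p r => {m | p ∈ X ∧ m ∈ E p r}) r n q}, m = e * n}, b = c * d) ∧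
      m = a * b := by
  have hmono : ∀ {p m q}, LabelledPath (fun p r => {m | p ∈ X ∧ m ∈ E p r}) p m q →
      LabelledPath (fun p r => {m | p ∈ insert x X ∧ m ∈ E p r}) p m q :=
    fun h => h.mono fun _ _ _ hm => ⟨.inr hm.1, hm.2⟩
  constructor
  · intro h
    induction h with
    | nil => exact .inl (nil _)
    | @cons p r q m n hm _ ih =>
      obtain ⟨rfl | hp, hm⟩ := hm
      · rcases ih with h | ⟨a, ha, _, ⟨c, hc, d, hd, rfl⟩, rfl⟩
        · exact .inr ⟨1, nil _, m * n, ⟨1, one_mem _, m * n,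
            Set.mem_iUnion.2 ⟨r, m, hm, n, h, rfl⟩, by simp⟩, by simp⟩
        · exact .inr ⟨1, nil _, _, ⟨m * a * c, mul_mem (Submonoid.subset_closure
            (Set.mem_iUnion.2 ⟨r, m, hm, a, ha, rfl⟩)) hc, d, hd, rfl⟩, by simp [mul_assoc]⟩
      · rcases ih with h | ⟨a, ha, b, hb, rfl⟩
        · exact .inl (cons ⟨hp, hm⟩ h)
        · exact .inr ⟨m * a, cons ⟨hp, hm⟩ ha, b, hb, by simp [mul_assoc]⟩
  · rintro (h | ⟨a, ha, _, ⟨c, hc, d, hd, rfl⟩, rfl⟩)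
    · exact hmono h
    · refine (hmono ha).trans (trans (q := x) ?_ ?_)
      · induction hc using Submonoid.closure_induction with
        | mem c hc =>
          obtain ⟨r, e, he, n, hn, rfl⟩ := Set.mem_iUnion.1 hc
          exact cons ⟨.inl rfl, he⟩ (hmono hn)
        | one => exact nil _
        | mul _ _ _ _ h₁ h₂ => exact h₁.trans h₂
      · obtain ⟨r, e, he, n, hn, rfl⟩ := Set.mem_iUnion.1 hd
        exact cons ⟨.inl rfl, he⟩ (hmono hn)

theorem isRationalSet [Finite Q] (hE : ∀ p q, IsRationalSet (E p q)) (p q : Q) :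
    IsRationalSet {m | LabelledPath E p m q} := by
  suffices h : ∀ X : Set Q, X.Finite → ∀ p q,
      IsRationalSet {m | LabelledPath (fun p r => {m | p ∈ X ∧ m ∈ E p r}) p m q} by
    simpa using h Set.univ Set.finite_univ p q
  intro X hX
  induction X, hX using Set.Finite.induction_on with
  | empty =>
    intro p q
    apply Set.Finite.isRationalSet
    refine (Set.finite_singleton 1).subset ?_
    rintro m hm
    cases hm with
    | nil => rfl
    | cons h _ => exact h.1.elim
  | @insert x X _ _ ih =>
    intro p q
    have := (ih p q).union ((ih p x).mul ((IsRationalSet.star (IsRationalSet.iUnion fun r =>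
      (hE x r).mul (ih r x))).mul (IsRationalSet.iUnion fun r => (hE x r).mul (ih r q))))
    convert this using 1
    ext m
    exact insert_iff

end LabelledPath

end Kleene

/-! ### Relations recognized by two-tape automata are rational -/

namespace TwoTapeAutomaton

variable {α σ : Type*} (M : TwoTapeAutomaton α σ)

/-- The labels of the edges of the graph that simulates `M`. A vertex consists of a state of `M` and
of two flags telling whether the end markers of the two tapes have been read. -/
def edgeLabels (p q : σ × Bool × Bool) : Set (FreeMonoid α × FreeMonoid α) :=
  {m | (M.tape p.1 = Tape.left ∧ p.2.1 = false ∧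
      ((∃ a, m = (FreeMonoid.of a, 1) ∧ q = (M.step p.1 (some a), p.2)) ∨
        m = 1 ∧ q = (M.step p.1 none, true, p.2.2))) ∨
    (M.tape p.1 = Tape.right ∧ p.2.2 = false ∧
      ((∃ a, m = (1, FreeMonoid.of a) ∧ q = (M.step p.1 (some a), p.2)) ∨
        m = 1 ∧ q = (M.step p.1 none, p.2.1, true)))}

/-- The unread contents of a tape, given whether the end marker has been read. -/
def unread (f : Bool) (u : FreeMonoid α) : List (Option α) :=
  if f then [] else u.toList.map some ++ [none]

variable {M}

/-- The last two conclusions are needed for the induction: `unread true` forgets its word, so the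
label must be known to be trivial on a finished tape. -/
theorem acceptsFrom_of_labelledPath {p q : σ × Bool × Bool} {m : FreeMonoid α × FreeMonoid α}
    (h : LabelledPath M.edgeLabels p m q) (hq : q.1 ∈ M.accept ∧ q.2 = (true, true)) :
    M.AcceptsFrom p.1 (unread p.2.1 m.1) (unread p.2.2 m.2) ∧
      (p.2.1 = true → m.1 = 1) ∧ (p.2.2 = true → m.2 = 1) := by
  induction h with
  | nil q =>
    obtain ⟨q, f, g⟩ := q
    obtain ⟨h, h'⟩ := hq
    simp only [Prod.mk.injEq] at h'
    obtain ⟨rfl, rfl⟩ := h'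
    exact ⟨.done h, fun _ => rfl, fun _ => rfl⟩
  | @cons p r q m n hm _ ih' =>
    obtain ⟨p, f, g⟩ := p
    obtain ⟨ih, ih₁, ih₂⟩ := ih' hq
    rcases hm with ⟨ht, hf, ⟨a, rfl, rfl⟩ | ⟨rfl, rfl⟩⟩ | ⟨ht, hf, ⟨a, rfl, rfl⟩ | ⟨rfl, rfl⟩⟩ <;>
      dsimp only at ht hf ih ih₁ ih₂ <;> subst hf
    · exact ⟨by simpa [unread] using AcceptsFrom.left ht ih, by simp, by simpa using ih₂⟩
    · refine ⟨?_, by simp, by simpa using ih₂⟩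
      have := AcceptsFrom.left ht ih
      simpa [unread, ih₁ rfl] using this
    · exact ⟨by simpa [unread] using AcceptsFrom.right ht ih, by simpa using ih₁, by simp⟩
    · refine ⟨?_, by simpa using ih₁, by simp⟩
      have := AcceptsFrom.right ht ih
      simpa [unread, ih₂ rfl] using this

theorem unread_eq_cons {f : Bool} {u : FreeMonoid α} {c : Option α} {x : List (Option α)}
    (h : c :: x = unread f u) : f = false ∧
      ((∃ a u', c = some a ∧ u = FreeMonoid.of a * u' ∧ x = unread false u') ∨
        c = none ∧ u = 1 ∧ x = unread true u) := by
  cases f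
  · refine ⟨rfl, ?_⟩
    cases u using FreeMonoid.casesOn with
    | one =>
      simp only [unread, FreeMonoid.toList_one, List.map_nil, List.nil_append] at h
      injection h with h₁ h₂
      exact .inr ⟨h₁, rfl, h₂⟩
    | of_mul a u =>
      simp only [unread, FreeMonoid.toList_of_mul, List.map_cons, List.cons_append] at h
      injection h with h₁ h₂
      exact .inl ⟨a, u, h₁, rfl, h₂⟩
  · simp [unread] at h

theorem unread_eq_nil {f : Bool} {u : FreeMonoid α} (h : [] = unread f u) : f = true := by
  cases f
  · simp [unread] at h
  · rfl

theorem AcceptsFrom.exists_labelledPath {q : σ} {x y : List (Option α)}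
    (h : M.AcceptsFrom q x y) {f g : Bool} {u v : FreeMonoid α} (hx : x = unread f u)
    (hy : y = unread g v) (hf : f = true → u = 1) (hg : g = true → v = 1) :
    ∃ q' ∈ M.accept, LabelledPath M.edgeLabels (q, f, g) (u, v) (q', true, true) := by
  induction h generalizing f g u v with
  | @done q h =>
    obtain rfl := unread_eq_nil hx
    obtain rfl := unread_eq_nil hy
    obtain rfl := hf rfl
    obtain rfl := hg rfl
    exact ⟨q, h, .nil _⟩
  | left ht _ ih =>
    obtain ⟨rfl, ⟨a, u', rfl, rfl, hx'⟩ | ⟨rfl, rfl, hx'⟩⟩ := unread_eq_cons hx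
    · obtain ⟨q', hq', hp⟩ := ih hx' hy (by simp) hg
      refine ⟨q', hq', ?_⟩
      simpa using LabelledPath.cons (m := (FreeMonoid.of a, 1))
        (.inl ⟨ht, rfl, .inl ⟨a, rfl, rfl⟩⟩) hp
    · obtain ⟨q', hq', hp⟩ := ih hx' hy (fun _ => rfl) hg
      refine ⟨q', hq', ?_⟩
      simpa using LabelledPath.cons (m := 1) (.inl ⟨ht, rfl, .inr ⟨rfl, rfl⟩⟩) hp
  | right ht _ ih =>
    obtain ⟨rfl, ⟨a, u', rfl, rfl, hx'⟩ | ⟨rfl, rfl, hx'⟩⟩ := unread_eq_cons hy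
    · obtain ⟨q', hq', hp⟩ := ih hx hx' hf (by simp)
      refine ⟨q', hq', ?_⟩
      simpa using LabelledPath.cons (m := (1, FreeMonoid.of a))
        (.inr ⟨ht, rfl, .inl ⟨a, rfl, rfl⟩⟩) hp
    · obtain ⟨q', hq', hp⟩ := ih hx hx' hf (fun _ => rfl)
      refine ⟨q', hq', ?_⟩
      simpa using LabelledPath.cons (m := 1) (.inr ⟨ht, rfl, .inr ⟨rfl, rfl⟩⟩) hp

theorem finite_edgeLabels [Finite α] (p q : σ × Bool × Bool) : (M.edgeLabels p q).Finite := by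
  refine ((Set.finite_range fun a : α => ((FreeMonoid.of a, 1) : FreeMonoid α × FreeMonoid α)).union
    ((Set.finite_range fun a : α => ((1, FreeMonoid.of a) : FreeMonoid α × FreeMonoid α)).union
      (Set.finite_singleton 1))).subset ?_
  rintro m (⟨-, -, ⟨a, rfl, -⟩ | ⟨rfl, -⟩⟩ | ⟨-, -, ⟨a, rfl, -⟩ | ⟨rfl, -⟩⟩)
  exacts [.inl ⟨a, rfl⟩, .inr (.inr rfl), .inr (.inl ⟨a, rfl⟩), .inr (.inr rfl)]

end TwoTapeAutomaton

theorem IsTwoTapeRecognizable.isRationalSet {α : Type*} [Finite α]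
    {R : Set (FreeMonoid α × FreeMonoid α)} (hR : IsTwoTapeRecognizable R) : IsRationalSet R := by
  obtain ⟨σ, _, M, rfl⟩ := hR
  have := IsRationalSet.biUnion (Set.toFinite M.accept) fun q _ =>
    LabelledPath.isRationalSet (fun p q => (M.finite_edgeLabels p q).isRationalSet)
      (M.start, false, false) (q, true, true)
  convert this using 1
  ext ⟨u, v⟩
  simp only [Set.mem_iUnion, exists_prop]
  constructor
  · intro h
    exact TwoTapeAutomaton.AcceptsFrom.exists_labelledPath h rfl rfl (by simp) (by simp)
  · rintro ⟨q, hq, h⟩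
    exact (TwoTapeAutomaton.acceptsFrom_of_labelledPath h ⟨hq, rfl⟩).1

/-! ### Determinization of relations of bounded delay -/

namespace TwoTapeAutomaton

variable {α σ τ : Type*}

/-- Renaming the states of a two-tape automaton. -/
def reindex (M : TwoTapeAutomaton α σ) (e : σ ≃ τ) : TwoTapeAutomaton α τ where
  tape q := M.tape (e.symm q)
  step q c := e (M.step (e.symm q) c)
  start := e M.start
  accept := e.symm ⁻¹' M.accept

theorem AcceptsFrom.reindex {M : TwoTapeAutomaton α σ} (e : σ ≃ τ) {q : σ}
    {x y : List (Option α)} (h : M.AcceptsFrom q x y) :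
    (M.reindex e).AcceptsFrom (e q) x y := by
  induction h with
  | done h => exact .done (by simpa [TwoTapeAutomaton.reindex] using h)
  | left ht _ ih =>
    exact .left (by simpa [TwoTapeAutomaton.reindex] using ht)
      (by simpa [TwoTapeAutomaton.reindex] using ih)
  | right ht _ ih =>
    exact .right (by simpa [TwoTapeAutomaton.reindex] using ht)
      (by simpa [TwoTapeAutomaton.reindex] using ih)

theorem recognized_reindex (M : TwoTapeAutomaton α σ) (e : σ ≃ τ) :
    (M.reindex e).recognized = M.recognized := by
  ext p
  refine ⟨fun h => ?_, fun h => AcceptsFrom.reindex e h⟩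
  have := AcceptsFrom.reindex e.symm h
  simpa [reindex, recognized] using this

/-- Renaming the states by `Fin n` brings them into the universe `Type`. -/
theorem isTwoTapeRecognizable [Finite σ] (M : TwoTapeAutomaton α σ) :
    IsTwoTapeRecognizable M.recognized := by
  obtain ⟨n, ⟨e⟩⟩ := Finite.exists_equiv_fin σ
  exact ⟨Fin n, inferInstance, M.reindex e, M.recognized_reindex e⟩

end TwoTapeAutomaton

theorem exists_eq_map_inr_or {α : Type*} (w : List (α ⊕ α)) :
    (∃ s : List α, w = s.map Sum.inr) ∨ ∃ (s : List α) (a : α) (z : List (α ⊕ α)),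
      w = s.map Sum.inr ++ Sum.inl a :: z := by
  induction w with
  | nil => exact .inl ⟨[], rfl⟩
  | cons c w ih =>
    rcases c with a | b
    · exact .inr ⟨[], a, w, rfl⟩
    · rcases ih with ⟨s, rfl⟩ | ⟨s, a, z, rfl⟩
      · exact .inl ⟨b :: s, rfl⟩
      · exact .inr ⟨b :: s, a, z, rfl⟩

namespace DFA

variable {α σ : Type*} (M : DFA (α ⊕ α) σ) (D : ℕ)

/-- Configurations of the simulation of a two-tape reading of `M`: a state of `M`, and a word
already read on the right tape but not yet processed by `M`. -/
abbrev DelayConfig (α σ : Type*) (D : ℕ) : Type _ := σ × {t : List α // t.length ≤ D + 1}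

/-- The simulation goes on with the left tape if the right tape is exhausted or some configuration
that can still lead to acceptance has maximal delay. -/
def ReadsLeft (S : Set (DelayConfig α σ D)) (f : Bool) : Prop :=
  f = true ∨ ∃ c ∈ S, (∃ z, M.evalFrom c.1 z ∈ M.accept) ∧ c.2.1.length = D + 1

/-- The configurations reached by processing a letter of the left tape. -/
def leftStep (S : Set (DelayConfig α σ D)) (a : α) : Set (DelayConfig α σ D) :=
  {c' | ∃ c ∈ S, ∃ s : List α, c.2.1 = s ++ c'.2.1 ∧
    c'.1 = M.evalFrom c.1 (s.map Sum.inr ++ [Sum.inl a])}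

/-- The configurations reached by storing a letter of the right tape. -/
def rightStep (S : Set (DelayConfig α σ D)) (b : α) : Set (DelayConfig α σ D) :=
  {c' | ∃ c ∈ S, c'.1 = c.1 ∧ c'.2.1 = c.2.1 ++ [b]}

/-- Acceptance once both tapes are exhausted. -/
def AcceptsDelayed (S : Set (DelayConfig α σ D)) : Prop :=
  ∃ c ∈ S, M.evalFrom c.1 (c.2.1.map Sum.inr) ∈ M.accept

open Classical in
/-- The deterministic two-tape automaton simulating all the readings of `M` whose delay is bounded
by `D + 1`. -/
noncomputable def determinize :
    TwoTapeAutomaton α ((Set (DelayConfig α σ D) × Bool) ⊕ Prop) where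
  tape
    | .inl (S, f) => if M.ReadsLeft D S f then .left else .right
    | .inr _ => .left
  step
    | .inl (S, f), some a =>
      .inl (if M.ReadsLeft D S f then M.leftStep D S a else rightStep D S a, f)
    | .inl (S, f), none =>
      if f then .inr (M.AcceptsDelayed D S)
      else if M.ReadsLeft D S f then .inr False else .inl (S, true)
    | .inr _, _ => .inr False
  start := .inl ({(M.start, ⟨[], by simp⟩)}, false)
  accept := {q | q.elim (fun _ => False) id}

variable {M D}

theorem determinize_tape_eq_left {S : Set (DelayConfig α σ D)} {f : Bool} :
    (M.determinize D).tape (.inl (S, f)) = .left ↔ M.ReadsLeft D S f := by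
  simp [determinize]

theorem determinize_tape_eq_right {S : Set (DelayConfig α σ D)} {f : Bool} :
    (M.determinize D).tape (.inl (S, f)) = .right ↔ ¬ M.ReadsLeft D S f := by
  simp [determinize]

theorem determinize_step_of_readsLeft {S : Set (DelayConfig α σ D)} {f : Bool}
    (h : M.ReadsLeft D S f) (a : α) :
    (M.determinize D).step (.inl (S, f)) (some a) = .inl (M.leftStep D S a, f) := by
  simp [determinize, h]

theorem determinize_step_of_not_readsLeft {S : Set (DelayConfig α σ D)} {f : Bool}
    (h : ¬ M.ReadsLeft D S f) (a : α) :
    (M.determinize D).step (.inl (S, f)) (some a) = .inl (rightStep D S a, f) := by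
  simp [determinize, h]

theorem determinize_step_true_none {S : Set (DelayConfig α σ D)} :
    (M.determinize D).step (.inl (S, true)) none = .inr (M.AcceptsDelayed D S) := by
  simp [determinize]

theorem determinize_step_false_none {S : Set (DelayConfig α σ D)}
    (h : ¬ M.ReadsLeft D S false) :
    (M.determinize D).step (.inl (S, false)) none = .inl (S, true) := by
  simp [determinize, h]

theorem determinize_step_false_none_of_readsLeft {S : Set (DelayConfig α σ D)}
    (h : M.ReadsLeft D S false) :
    (M.determinize D).step (.inl (S, false)) none = .inr False := by
  simp [determinize, h]

/-- Every transition out of an `.inr` state leads to `.inr False`, from which nothing is accepted.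
-/
theorem of_acceptsFrom_inr {p : Prop} {x y : List (Option α)}
    (h : (M.determinize D).AcceptsFrom (.inr p) x y) : p := by
  generalize hq : (Sum.inr p : (Set (DelayConfig α σ D) × Bool) ⊕ Prop) = q at h
  revert p
  induction h with
  | done h => rintro p rfl; exact h
  | left _ _ ih => rintro p rfl; exact (ih (p := False) rfl).elim
  | right _ _ ih => rintro p rfl; exact (ih (p := False) rfl).elim

/-- Each configuration comes from a genuine partial reading, so a successful one can be traced back
step by step; no bound on delays is needed. -/
theorem determinize_sound {S : Set (DelayConfig α σ D)} {f : Bool} {u v : List α}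
    (h : (M.determinize D).AcceptsFrom (.inl (S, f)) (u.map some ++ [none])
      (if f then [] else v.map some ++ [none])) (hf : f = true → v = []) :
    ∃ c ∈ S, ∃ z, M.evalFrom c.1 z ∈ M.accept ∧ lefts z = u ∧ rights z = c.2.1 ++ v := by
  generalize hx : u.map some ++ [none] = x at h
  generalize hy : (if f then [] else v.map some ++ [none]) = y at h
  generalize hq : (Sum.inl (S, f) : (Set (DelayConfig α σ D) × Bool) ⊕ Prop) = q at h
  induction h generalizing S f u v with
  | done => simp at hx
  | left ht h ih =>
    subst hq
    rw [determinize_tape_eq_left] at ht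
    cases u with
    | nil =>
      obtain ⟨rfl, rfl⟩ : none = _ ∧ [] = _ := by simpa using hx
      cases f with
      | false =>
        rw [determinize_step_false_none_of_readsLeft ht] at h
        exact (of_acceptsFrom_inr h).elim
      | true =>
        rw [determinize_step_true_none] at h
        obtain ⟨c, hc, hacc⟩ := of_acceptsFrom_inr h
        exact ⟨c, hc, _, hacc, by simp, by simp [hf rfl]⟩
    | cons a u =>
      obtain ⟨rfl, rfl⟩ : some a = _ ∧ u.map some ++ [none] = _ := by simpa using hx
      obtain ⟨c', ⟨c, hc, s, hs, he⟩, z, hz, rfl, hr⟩ :=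
        ih hf rfl hy (determinize_step_of_readsLeft ht a).symm
      refine ⟨c, hc, s.map Sum.inr ++ [Sum.inl a] ++ z, ?_, by simp, by simp [hr, hs]⟩
      rwa [evalFrom_of_append, ← he]
  | right ht h ih =>
    subst hq
    rw [determinize_tape_eq_right] at ht
    obtain rfl : f = false := by
      by_contra hne
      exact ht (.inl (by simpa using hne))
    cases v with
    | nil =>
      obtain ⟨rfl, rfl⟩ : none = _ ∧ [] = _ := by simpa using hy
      exact ih (f := true) (v := []) (fun _ => rfl) hx rfl (determinize_step_false_none ht).symm
    | cons b v =>
      obtain ⟨rfl, rfl⟩ : some b = _ ∧ v.map some ++ [none] = _ := by simpa using hy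
      obtain ⟨c', ⟨c, hc, h₁, h₂⟩, z, hz, hl, hr⟩ :=
        ih (f := false) (v := v) (by simp) hx rfl (determinize_step_of_not_readsLeft ht b).symm
      exact ⟨c, hc, z, h₁ ▸ hz, hl, by simp [hr, h₂]⟩

/-- A reading of two words lags behind, on the right tape, all the other readings compatible with
these words by at most `D` letters. -/
def HasBoundedDelay (M : DFA (α ⊕ α) σ) (D : ℕ) : Prop :=
  ∀ w w' z, w ++ w' ∈ M.accepts → (∃ z', z ++ z' ∈ M.accepts) → lefts z = lefts w →
    rights z <+: rights (w ++ w') → (rights w).length ≤ (rights z).length + D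

/-- The configuration of one successful reading `w₁ ++ w₂` is followed through the simulation, with
`t` as its buffer. The bound on delays ensures that it never has to process a right letter not yet
stored, and `hsound` makes that bound applicable to the other configurations. -/
theorem determinize_complete (hM : M.HasBoundedDelay D) {w₁ w₂ : List (α ⊕ α)}
    (hw : w₁ ++ w₂ ∈ M.accepts) {u : List α} {v t : List α} (hu : lefts w₂ = u)
    (hv : rights w₂ = t ++ v) (ht : t.length ≤ D + 1) {S : Set (DelayConfig α σ D)}
    (hS : (M.eval w₁, ⟨t, ht⟩) ∈ S)
    (hsound : ∀ c ∈ S, ∃ z, M.eval z = c.1 ∧ lefts z = lefts w₁ ∧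
      rights z ++ c.2.1 = rights w₁ ++ t) {f : Bool} (hf : f = true → v = []) :
    (M.determinize D).AcceptsFrom (.inl (S, f)) (u.map some ++ [none])
      (if f then [] else v.map some ++ [none]) := by
  obtain ⟨n, hn⟩ : ∃ n, u.length + v.length + (if f then 0 else 1) < n := ⟨_, Nat.lt_succ_self _⟩
  induction n generalizing w₁ w₂ u v t S f with
  | zero => omega
  | succ n ih =>
  have hco : ∃ z, M.evalFrom (M.eval w₁) z ∈ M.accept := ⟨w₂, append_mem_accepts.1 hw⟩
  by_cases hl : M.ReadsLeft D S f
  -- A live configuration with buffer length `D + 1` lags behind the followed one by `D + 1 -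
  -- t.length` right letters; bounded delay allows at most `D - s.length`. Strictness also excludes
  -- that `w₂` consists of right letters only, so the left tape is not exhausted.
  · have hbound : ∀ s : List α, s.map Sum.inr <+: w₂ → f = true ∨ s.length < t.length := by
      rintro s ⟨w₃, rfl⟩
      rcases hl with h | ⟨c, hc, ⟨z', hz'⟩, hlen⟩
      · exact .inl h
      right
      obtain ⟨z, hz, hz₁, hz₂⟩ := hsound c hc
      have := hM (w₁ ++ s.map Sum.inr) w₃ z (by simpa using hw)
        ⟨z', append_mem_accepts.2 (hz ▸ hz')⟩ (by simp [hz₁])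
        ⟨c.2.1 ++ v, by
          rw [List.append_assoc, rights_append, hv, ← List.append_assoc, hz₂, List.append_assoc]⟩
      have hlen' := congrArg List.length hz₂
      simp only [rights_append, rights_map_inr, List.length_append] at this hlen'
      omega
    rcases exists_eq_map_inr_or w₂ with ⟨s, rfl⟩ | ⟨s, a, w₃, rfl⟩
    · rw [rights_map_inr] at hv
      obtain rfl : f = true := by
        rcases hbound s List.prefix_rfl with h | h
        · exact h
        · have := congrArg List.length hv
          simp only [List.length_append] at this
          omega
      obtain rfl := hf rfl
      rw [List.append_nil] at hv
      subst hv
      rw [lefts_map_inr] at hu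
      subst hu
      refine .left (determinize_tape_eq_left.2 hl) ?_
      rw [determinize_step_true_none]
      exact .done ⟨_, hS, append_mem_accepts.1 hw⟩
    · simp only [lefts_append, lefts_map_inr, lefts_cons_inl, List.nil_append] at hu
      subst hu
      simp only [rights_append, rights_map_inr, rights_cons_inl] at hv
      obtain ⟨t', rfl, hv'⟩ : ∃ t', t = s ++ t' ∧ rights w₃ = t' ++ v := by
        rcases List.append_eq_append_iff.1 hv with ⟨c, rfl, h⟩ | ⟨c, rfl, rfl⟩
        · exact ⟨c, rfl, h⟩
        · rcases hbound (t ++ c) (by simp) with h | h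
          · obtain ⟨rfl, h⟩ := List.append_eq_nil_iff.1 (hf h)
            exact ⟨[], by simp, by simp [h]⟩
          · simp only [List.length_append] at h
            omega
      have ht' : t'.length ≤ D + 1 := by
        simp only [List.length_append] at ht
        omega
      refine .left (determinize_tape_eq_left.2 hl) ?_
      rw [determinize_step_of_readsLeft hl]
      have hS' : (M.eval (w₁ ++ (s.map Sum.inr ++ [Sum.inl a])),
          (⟨t', ht'⟩ : {t : List α // t.length ≤ D + 1})) ∈ M.leftStep D S a := by
        refine ⟨_, hS, s, rfl, ?_⟩
        simp only [DFA.eval, evalFrom_of_append]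
      refine ih (w₁ := w₁ ++ (s.map Sum.inr ++ [Sum.inl a])) (w₂ := w₃)
        (by simpa using hw) rfl hv' ht' hS' ?_ hf ?_
      · rintro c' ⟨c, hc, s', hs', he⟩
        obtain ⟨z, hz, hz₁, hz₂⟩ := hsound c hc
        refine ⟨z ++ (s'.map Sum.inr ++ [Sum.inl a]), ?_, by simp [hz₁], ?_⟩
        · rw [he, ← hz]
          simp only [DFA.eval, evalFrom_of_append]
        · rw [hs'] at hz₂
          simpa using hz₂
      · simp only [List.length_cons] at hn
        omega
  · obtain rfl : f = false := by
      by_contra hne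
      exact hl (.inl (by simpa using hne))
    -- The followed configuration is live, so its buffer has room for one more letter.
    have hlt : t.length < D + 1 :=
      lt_of_le_of_ne ht fun h => hl (.inr ⟨_, hS, hco, h⟩)
    cases v with
    | nil =>
      refine .right (determinize_tape_eq_right.2 hl) ?_
      rw [determinize_step_false_none hl]
      exact ih (f := true) hw hu hv ht hS hsound (fun _ => rfl) (by simp at hn ⊢; omega)
    | cons b v =>
      refine .right (determinize_tape_eq_right.2 hl) ?_
      rw [determinize_step_of_not_readsLeft hl]
      have ht' : (t ++ [b]).length ≤ D + 1 := by simpa using hlt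
      have hS' : (M.eval w₁, (⟨t ++ [b], ht'⟩ : {t : List α // t.length ≤ D + 1})) ∈
        rightStep D S b := ⟨_, hS, rfl, rfl⟩
      refine ih (f := false) (v := v) hw hu (by simpa using hv) ht' hS' ?_ (by simp)
        (by simp at hn ⊢; omega)
      rintro c' ⟨c, hc, h₁, h₂⟩
      obtain ⟨z, hz, hz₁, hz₂⟩ := hsound c hc
      refine ⟨z, by rw [hz, h₁], hz₁, ?_⟩
      rw [h₂, ← List.append_assoc, hz₂, List.append_assoc]

theorem HasBoundedDelay.isTwoTapeRecognizable [Finite α] [Finite σ] (hM : M.HasBoundedDelay D) :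
    IsTwoTapeRecognizable (toPair '' {w | w ∈ M.accepts}) := by
  have : Finite {t : List α // t.length ≤ D + 1} := (List.finite_length_le α (D + 1)).to_subtype
  convert (M.determinize D).isTwoTapeRecognizable using 1
  ext ⟨u, v⟩
  constructor
  · rintro ⟨w, hw, h⟩
    simp only [toPair, Prod.mk.injEq] at h
    obtain ⟨rfl, rfl⟩ := h
    refine determinize_complete hM (w₁ := []) (f := false) (t := []) (v := rights w)
      (S := {(M.start, ⟨[], by simp⟩)}) hw rfl rfl (by simp) (Set.mem_singleton _) ?_
      (by simp)
    rintro c rfl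
    exact ⟨[], rfl, rfl, rfl⟩
  · intro h
    obtain ⟨c, rfl, z, hz, rfl, hr⟩ := determinize_sound (f := false) h (by simp)
    exact ⟨z, hz, Prod.ext rfl hr⟩

end DFA

/-! ### Reduced words of a dictionary -/

/-- The left letters cut the interleaving into `(lefts w).length + 1` blocks of right letters. -/
theorem length_rights_le_of_forall_infix {α : Type*} {N : ℕ} (w : List (α ⊕ α))
    (h : ∀ s : List α, s.map Sum.inr <:+: w → s.length ≤ N) :
    (rights w).length ≤ N * ((lefts w).length + 1) := by
  obtain ⟨n, hn⟩ : ∃ n, w.length < n := ⟨_, Nat.lt_succ_self _⟩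
  induction n generalizing w with
  | zero => omega
  | succ n ih =>
  rcases exists_eq_map_inr_or w with ⟨s, rfl⟩ | ⟨s, a, z, rfl⟩
  · simpa using h s List.infix_rfl
  · have h₁ := h s ⟨[], _, rfl⟩
    have h₂ := ih z (fun s' hs' => h s' (hs'.trans ⟨s.map Sum.inr ++ [Sum.inl a], [], by simp⟩))
      (by simp at hn; omega)
    simp only [rights_append, rights_map_inr, rights_cons_inl, lefts_append, lefts_map_inr,
      lefts_cons_inl, List.nil_append, List.length_append, List.length_cons]
    linarith

section Dictionaries

variable {G : Type*} [Group G] {A : Finset G}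

/-- The element of the group represented by a word. -/
def wordValue (w : List A) : G := (w.map fun a : A => (a : G)).prod

@[simp] theorem wordValue_append (u v : List A) :
    wordValue (u ++ v) = wordValue u * wordValue v := by
  simp [wordValue]

theorem lift_ofList_eq_wordValue (w : List A) :
    FreeMonoid.lift (fun a : A => (a : G)) (FreeMonoid.ofList w) = wordValue w := by
  rw [FreeMonoid.lift_apply]
  rfl

theorem toPair_mem_multiplierRelation {L : Language A} {a : Option A} {w : List (A ⊕ A)} :
    toPair w ∈ multiplierRelation A L a ↔ lefts w ∈ L ∧ rights w ∈ L ∧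
      wordValue (lefts w) * a.elim 1 (fun b => (b : G)) = wordValue (rights w) := by
  have h : FreeMonoid.lift (fun b : A => (b : G)) (a.elim 1 FreeMonoid.of) =
      a.elim 1 (fun b => (b : G)) := by
    cases a <;> simp
  simp only [multiplierRelation, toPair, Set.mem_ofPred_eq, map_mul, lift_ofList_eq_wordValue, h,
    FreeMonoid.toList_ofList]

/-- The words of `L` that do not arise from another word of `L` by the insertion of a nonempty
factor of length at most `N` with trivial value. -/
def reducedWords (L : Language A) (N : ℕ) : Language A :=
  L ⊓ (L.insertFactor {t | t ≠ [] ∧ t.length ≤ N ∧ wordValue t = 1})ᶜ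

theorem mem_reducedWords {L : Language A} {N : ℕ} {w : List A} :
    w ∈ reducedWords L N ↔ w ∈ L ∧
      ∀ x t y, w = x ++ t ++ y → t ≠ [] → t.length ≤ N → wordValue t = 1 → x ++ y ∉ L := by
  constructor
  · rintro ⟨h, h'⟩
    exact ⟨h, fun x t y hw h₁ h₂ h₃ hL => h' ⟨x, y, t, ⟨h₁, h₂, h₃⟩, hw, hL⟩⟩
  · rintro ⟨h, h'⟩
    refine ⟨h, ?_⟩
    rintro ⟨x, y, t, ⟨h₁, h₂, h₃⟩, hw, hL⟩
    exact h' x t y hw h₁ h₂ h₃ hL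

theorem Language.IsRegular.reducedWords {L : Language A} (hL : L.IsRegular) (N : ℕ) :
    (reducedWords L N).IsRegular :=
  hL.inf (hL.insertFactor ((List.finite_length_le A N).subset fun _ ht => ht.2.1)).compl

theorem exists_mem_reducedWords {L : Language A} (N : ℕ) {w : List A} (hw : w ∈ L) :
    ∃ v ∈ reducedWords L N, wordValue v = wordValue w := by
  obtain ⟨n, hn⟩ : ∃ n, w.length < n := ⟨_, Nat.lt_succ_self _⟩
  induction n generalizing w with
  | zero => omega
  | succ n ih =>
  by_cases h : w ∈ reducedWords L N
  · exact ⟨w, h, rfl⟩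
  · rw [mem_reducedWords] at h
    push Not at h
    obtain ⟨x, t, y, rfl, ht, -, ht', hxy⟩ := h hw
    have := List.length_pos_iff.2 ht
    obtain ⟨v, hv, hv'⟩ := ih hxy (by simp at hn ⊢; omega)
    exact ⟨v, hv, by simp [hv', ht']⟩

theorem IsDictionary.reducedWords {L : Language A} (hL : IsDictionary A L) (N : ℕ) :
    IsDictionary A (reducedWords L N) where
  regular := hL.regular.reducedWords N
  ne_nil w hw := hL.ne_nil w hw.1
  surjective g := by
    obtain ⟨w, hw, rfl⟩ := hL.surjective g
    obtain ⟨v, hv, hv'⟩ := exists_mem_reducedWords N hw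
    exact ⟨v, hv, by rw [lift_ofList_eq_wordValue, hv', lift_ofList_eq_wordValue]⟩

/-- A long block of right letters contains a loop of the automaton. Deleting it leaves the left word
unchanged and stays in the relation, so the deleted factor has trivial value, against reducedness.
-/
theorem length_lt_card_of_rights_mem_reducedWords {L : Language A} {σ : Type*} [Fintype σ]
    {M : DFA (A ⊕ A) σ} {a : Option A}
    (hM : ∀ w ∈ M.accepts, toPair w ∈ multiplierRelation A L a) {w : List (A ⊕ A)}
    (hw : w ∈ M.accepts) (hr : rights w ∈ reducedWords L (Fintype.card σ)) {s : List A}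
    (hs : s.map Sum.inr <:+: w) : s.length < Fintype.card σ := by
  by_contra! hlen
  obtain ⟨w₁, w₂, rfl⟩ := hs
  -- The loop `t` closes within the first `Fintype.card σ` letters, which gives the length bound
  -- built into `reducedWords`.
  obtain ⟨q, x, t, y, hsplit, hcard, ht, hx, hq, hy⟩ :=
    M.evalFrom_split (s := M.eval w₁) (x := s.map Sum.inr) (by simpa using hlen) rfl
  obtain ⟨xt, y, rfl, hxt, rfl⟩ := List.map_eq_append_iff.1 hsplit
  obtain ⟨x, t, rfl, rfl, rfl⟩ := List.map_eq_append_iff.1 hxt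
  have hw' : w₁ ++ (x ++ y).map Sum.inr ++ w₂ ∈ M.accepts := by
    rw [List.append_assoc, DFA.append_mem_accepts] at hw ⊢
    rw [DFA.evalFrom_of_append] at hw ⊢
    rw [List.map_append, DFA.evalFrom_of_append, hx, hy]
    exact hw
  obtain ⟨-, -, h₁⟩ := toPair_mem_multiplierRelation.1 (hM _ hw)
  obtain ⟨-, h₂, h₃⟩ := toPair_mem_multiplierRelation.1 (hM _ hw')
  simp only [lefts_append, lefts_map_inr, rights_append, rights_map_inr, wordValue_append,
    List.append_nil] at h₁ h₂ h₃
  rw [h₁] at h₃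
  have ht₁ : wordValue t = 1 := by
    simpa [mul_assoc] using h₃
  refine (mem_reducedWords.1 hr).2 (rights w₁ ++ x) t (y ++ rights w₂) (by simp)
    (by simpa using ht) ?_ ht₁ (by simpa using h₂)
  simp only [List.length_map] at hcard
  omega

theorem finite_reducedWords_fiber {L : Language A} (hL : IsDictionary A L) {σ : Type*} [Fintype σ]
    {M : DFA (A ⊕ A) σ}
    (hM : ∀ p, p ∈ multiplierRelation A L none ↔ ∃ w ∈ M.accepts, toPair w = p) (g : G) :
    {v : List A | v ∈ reducedWords L (Fintype.card σ) ∧ wordValue v = g}.Finite := by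
  -- One fixed `u` bounds the length of every reduced word with the same value.
  obtain ⟨u, hu, rfl⟩ := hL.surjective g
  rw [lift_ofList_eq_wordValue]
  refine (List.finite_length_le A (Fintype.card σ * (u.length + 1))).subset ?_
  rintro v ⟨hv, huv⟩
  obtain ⟨w, hw, hwuv⟩ := (hM (FreeMonoid.ofList u, FreeMonoid.ofList v)).1
    ⟨hu, hv.1, by
      rw [Option.elim_none, mul_one, lift_ofList_eq_wordValue, lift_ofList_eq_wordValue, huv]⟩
  obtain rfl : lefts w = u := congrArg Prod.fst hwuv
  obtain rfl : rights w = v := congrArg Prod.snd hwuv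
  exact length_rights_le_of_forall_infix w fun s hs =>
    (length_lt_card_of_rights_mem_reducedWords (fun w hw => (hM _).2 ⟨w, hw, rfl⟩) hw hv hs).le

/-! ### Bounded delay from finite fibres -/

/-- The context of an infix can be replaced by a fixed one depending only on the states before and
after it. For each such pair of states, `x ↦ u ++ x ++ v` is injective into a single finite fibre.
-/
theorem Language.IsRegular.finite_infix_fiber {L : Language A} (hL : L.IsRegular)
    (hfin : ∀ g : G, {v : List A | v ∈ L ∧ wordValue v = g}.Finite) (g : G) :
    {x : List A | (∃ u v, u ++ x ++ v ∈ L) ∧ wordValue x = g}.Finite := by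
  obtain ⟨σ, _, M, rfl⟩ := hL
  refine (Set.finite_iUnion fun p : σ × σ => ?_ : (⋃ p : σ × σ, {x : List A |
    ((∃ u, M.eval u = p.1) ∧ (∃ v, M.evalFrom p.2 v ∈ M.accept)) ∧ M.evalFrom p.1 x = p.2 ∧
      wordValue x = g}).Finite).subset ?_
  · by_cases h : (∃ u, M.eval u = p.1) ∧ (∃ v, M.evalFrom p.2 v ∈ M.accept)
    · obtain ⟨⟨u, hu⟩, v, hv⟩ := h
      refine ((hfin (wordValue u * g * wordValue v)).preimage
        (f := fun x => u ++ x ++ v) fun x _ y _ h => by simpa using h).subset ?_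
      rintro x ⟨-, hx, rfl⟩
      refine ⟨?_, by simp [mul_assoc]⟩
      change u ++ x ++ v ∈ M.accepts
      rw [List.append_assoc, DFA.append_mem_accepts, DFA.evalFrom_of_append, hu, hx]
      exact hv
    · simp [h]
  · rintro x ⟨⟨u, v, huv⟩, hx⟩
    rw [List.append_assoc, DFA.append_mem_accepts, DFA.evalFrom_of_append] at huv
    exact Set.mem_iUnion.2 ⟨(M.eval u, M.evalFrom (M.eval u) x),
      ⟨⟨u, rfl⟩, v, huv⟩, rfl, hx⟩

theorem DFA.exists_hasBoundedDelay {L : Language A} (hL : L.IsRegular)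
    (hfin : ∀ g : G, {v : List A | v ∈ L ∧ wordValue v = g}.Finite) {a : Option A}
    {τ : Type*} [Finite τ] {M : DFA (A ⊕ A) τ}
    (hM : ∀ w ∈ M.accepts, toPair w ∈ multiplierRelation A L a) : ∃ D, M.HasBoundedDelay D := by
  have hg : ∀ q, ∃ g : G, ∀ z, M.eval z = q → (∃ z', z ++ z' ∈ M.accepts) →
      wordValue (rights z) = wordValue (lefts z) * g := by
    intro q
    by_cases h : ∃ z', M.evalFrom q z' ∈ M.accept
    · obtain ⟨z', hz'⟩ := h
      -- Any completion `z'` from `q` to acceptance determines the quotient, by solving the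
      -- multiplier equation for `z ++ z'`.
      refine ⟨wordValue (lefts z') * a.elim 1 (fun b => (b : G)) * (wordValue (rights z'))⁻¹, ?_⟩
      rintro z rfl -
      obtain ⟨-, -, h⟩ := toPair_mem_multiplierRelation.1 (hM _ (append_mem_accepts.2 hz'))
      rw [lefts_append, rights_append, wordValue_append, wordValue_append] at h
      rw [← mul_assoc, ← mul_assoc, h, mul_inv_cancel_right]
    · refine ⟨1, ?_⟩
      rintro z rfl ⟨z', hz'⟩
      exact (h ⟨z', append_mem_accepts.1 hz'⟩).elim
  choose g hg using hg
  -- The excess of one reading over another has value `(g p.1)⁻¹ * g p.2` for a pair of states, so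
  -- `D` bounds the lengths of all infixes with such values.
  obtain ⟨D, hD⟩ := ((Set.finite_iUnion fun p : τ × τ =>
    hL.finite_infix_fiber hfin ((g p.1)⁻¹ * g p.2)).image List.length).bddAbove
  refine ⟨D, fun w w' z hw hz hl hr => ?_⟩
  rcases le_total (rights w).length (rights z).length with hle | hle
  · omega
  · obtain ⟨x, hx⟩ := List.prefix_of_prefix_length_le hr (by simp : rights w <+: _) hle
    have hwL := (toPair_mem_multiplierRelation.1 (hM _ hw)).2.1
    have h₁ := hg _ z rfl hz
    have h₂ := hg _ w rfl ⟨w', hw⟩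
    rw [← hx, wordValue_append, h₁, hl, mul_assoc, mul_right_inj] at h₂
    have : x.length ≤ D := hD ⟨x, Set.mem_iUnion.2 ⟨(M.eval z, M.eval w),
      ⟨rights z, rights w', by rwa [hx, ← rights_append]⟩, by rw [← h₂]; group⟩, rfl⟩
    rw [← hx, List.length_append]
    omega

theorem IsQuasiAutomaticDictionary.exists_isAsynchronouslyAutomaticDictionary {L : Language A}
    (hL : IsQuasiAutomaticDictionary A L) :
    ∃ L' : Language A, IsAsynchronouslyAutomaticDictionary A L' := by
  obtain ⟨hL, hR⟩ := hL
  obtain ⟨_, ⟨σ, _, M, rfl⟩, hM⟩ := (hR none).exists_isRegular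
  have hL' := hL.reducedWords (Fintype.card σ)
  have hfin := finite_reducedWords_fiber hL hM
  refine ⟨_, hL', fun a => ?_⟩
  obtain ⟨K, hK, hKR⟩ := (hR a).exists_isRegular
  -- Restricting `R_a` to reduced words intersects its interleavings with two inverse homomorphic
  -- images of the reduced language.
  obtain ⟨τ, _, N, hN⟩ := (hK.inf (hL'.regular.comapFlatMap
    (Sum.elim (fun a => [a]) fun _ => []))).inf (hL'.regular.comapFlatMap
    (Sum.elim (fun _ => []) fun a => [a]))
  have hmem : ∀ w, w ∈ N.accepts ↔ (w ∈ K ∧ lefts w ∈ reducedWords L (Fintype.card σ)) ∧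
      rights w ∈ reducedWords L (Fintype.card σ) := by
    intro w
    rw [hN]
    rfl
  have hNR : ∀ p, p ∈ multiplierRelation A (reducedWords L (Fintype.card σ)) a ↔
      ∃ w ∈ N.accepts, toPair w = p := by
    intro p
    constructor
    · rintro ⟨h₁, h₂, h₃⟩
      obtain ⟨w, hw, rfl⟩ := (hKR p).1 ⟨h₁.1, h₂.1, h₃⟩
      exact ⟨w, (hmem w).2 ⟨⟨hw, h₁⟩, h₂⟩, rfl⟩
    · rintro ⟨w, hw, rfl⟩
      obtain ⟨⟨hw, h₁⟩, h₂⟩ := (hmem w).1 hw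
      exact ⟨h₁, h₂, ((hKR _).2 ⟨w, hw, rfl⟩).2.2⟩
  obtain ⟨D, hD⟩ := DFA.exists_hasBoundedDelay hL'.regular hfin
    fun w hw => (hNR _).2 ⟨w, hw, rfl⟩
  convert hD.isTwoTapeRecognizable using 1
  ext p
  exact hNR p

end Dictionaries

theorem theorem1 (G : Type*) [Group G] [Group.FG G] :
    IsQuasiAutomatic G ↔ IsAsynchronouslyAutomatic G := by
  constructor
  · rintro ⟨A, L, h⟩
    exact ⟨A, h.exists_isAsynchronouslyAutomaticDictionary⟩
  · rintro ⟨A, L, hL, h⟩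
    exact ⟨A, L, hL, fun a => (h a).isRationalSet⟩
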